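/- Let $K$ be a field, $p,q\ge 0$ integers, $n=p+q$, let $c=(c_m)_{m\in\mathbb Z}$ be a doubly infinite sequence of elements of $K$, and let $x=(x_1,\dots,x_n)$ be pairwise distinct elements of $K$ with $x_i\ne c_m$ for all $i$ and all $m<0$. (For example, the $x_i$ and $c_m$ may be independent indeterminates over a field $k$ and $K=k(x,c)$.) Put $(\tau^r c)_m=c_{m+r}$ and, for $y \in K$ and $m\ge 0$, $(y|c)^m=(y-c_0)\cdots(y-c_{m-1})$; for $m>0$, put $(y|c)^{-m}=\frac{1}{(y-c_{-1})\cdots(y-c_{-m})}$ (used only where the denominator is nonzero). For $\lambda\in\mathbb Z^n$ let \[ s_\lambda(x|c)=\frac{\det\left[(x_i|c)^{\lambda_j+n-j}\right]_{i,j=1}^n}{\det\left[(x_i|c)^{n-j}\right]_{i,j=1}^n}. \] If $n\ge 1$, for $k\ge 0$ let $h_k(x|c)=s_{(k,0,\dots,0)}(x|c)$ and $g_k(x|c)=s_{(0,\dots,0,-k)-(1^n)}(x|c)$, where $(a^n)=(a,\dots,a)$ with $n$ entries; for $k<0$ let $h_k(x|c)=g_k(x|c)=0$. Theorem. Let $\mu=(\mu_1\ge\dots\ge\mu_p\ge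 0)$ and $\nu=(\nu_1\ge\dots\ge\nu_q\ge 0)$ be partitions, and let $\lambda=(\mu,\nu)$ be the signature $(\mu_1,\dots,\mu_p,-\nu_q,\dots,-\nu_1)$. Then \[ s_{\lambda-(q^n)}(x|c)=\det\left[\begin{array}{c} g_{\nu_{q-i+1}+i-j}(x|\tau^{1-j}c)\\ \hline h_{\mu_i-q-i+j}(x|\tau^{1-j}c)\end{array}\right], \] where $i=1,\dots,q$ in the upper block, $i=1,\dots,p$ in the lower block, and $j=1,\dots,n$ in both blocks. For $n=0$ both sides are $1$. -/

import Mathlib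

namespace FactorialSchur

/-- The shift operator `τ ^ r` on doubly infinite sequences: `(τ ^ r c)_m = c_{m + r}`. -/
def shift {K : Type*} (r : ℤ) (c : ℤ → K) : ℤ → K := fun m => c (m + r)

/-- The factorial power `(x | c) ^ m`, for every integer `m`:
`(x - c_0) ⋯ (x - c_{m-1})` for `m ≥ 0` and `1 / ((x - c_{-1}) ⋯ (x - c_m))` for `m < 0`. -/
def factPow {K : Type*} [Field K] (x : K) (c : ℤ → K) : ℤ → K
  | Int.ofNat m => ∏ l ∈ Finset.range m, (x - c (l : ℤ))
  | Int.negSucc m => (∏ l ∈ Finset.range (m + 1), (x - c (-((l : ℤ) + 1))))⁻¹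

/-- The factorial Schur function `s_lam (x | c)` in `n` variables as a ratio of alternants.
Indices start at `0`, so that the exponent `lam_j + n - j` reads `lam j + n - 1 - j`. -/
def schur {K : Type*} [Field K] {n : ℕ} (lam : Fin n → ℤ) (x : Fin n → K) (c : ℤ → K) : K :=
  (Matrix.of fun i j : Fin n => factPow (x i) c (lam j + (n : ℤ) - 1 - (j : ℤ))).det /
    (Matrix.of fun i j : Fin n => factPow (x i) c ((n : ℤ) - 1 - (j : ℤ))).det

/-- `h_k (x | c) = s_{(k, 0, …, 0)} (x | c)` for `k ≥ 0`, and `0` for `k < 0`. -/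
def complete {K : Type*} [Field K] {n : ℕ} (k : ℤ) (x : Fin n → K) (c : ℤ → K) : K :=
  if k < 0 then 0 else schur (fun i : Fin n => if (i : ℕ) = 0 then k else 0) x c

/-- `g_k (x | c) = s_{(0, …, 0, -k) - (1, …, 1)} (x | c)` for `k ≥ 0`, and `0` for `k < 0`. -/
def dualComplete {K : Type*} [Field K] {n : ℕ} (k : ℤ) (x : Fin n → K) (c : ℤ → K) : K :=
  if k < 0 then 0
  else schur (fun i : Fin n => (if (i : ℕ) + 1 = n then -k else 0) - 1) x c

/-- The integer sequence `(μ, ν) = (μ_1, …, μ_p, -ν_q, …, -ν_1)`. -/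
def composite {p q : ℕ} (μ : Fin p → ℕ) (ν : Fin q → ℕ) : Fin (p + q) → ℤ :=
  Fin.append (fun i => (μ i : ℤ)) (fun i => -(ν (Fin.rev i) : ℤ))

/-- The square matrix whose first `q` rows are `g_{ν_{q-i+1}+i-j} (x | τ^{1-j} c)` and whose last
`p` rows are `h_{μ_i-q-i+j} (x | τ^{1-j} c)`. Indices start at `0`, so that `ν_{q-i+1}` reads
`ν (Fin.rev i)` and `τ^{1-j}` reads `shift (-j)`. -/
def jacobiTrudiMatrix {K : Type*} [Field K] {p q : ℕ} (μ : Fin p → ℕ) (ν : Fin q → ℕ)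
    (x : Fin (p + q) → K) (c : ℤ → K) : Matrix (Fin (p + q)) (Fin (p + q)) K :=
  Matrix.of fun r j =>
    Fin.addCases (motive := fun _ : Fin (q + p) => K)
      (fun i : Fin q =>
        dualComplete ((ν (Fin.rev i) : ℤ) + (i : ℤ) - (j : ℤ)) x (shift (-(j : ℤ)) c))
      (fun i : Fin p =>
        complete ((μ i : ℤ) - (q : ℤ) - (i : ℤ) + (j : ℤ)) x (shift (-(j : ℤ)) c))
      (Fin.cast (Nat.add_comm p q) r)

end FactorialSchur

/-!
For pairwise distinct nodes `x_1, …, x_n`, write `D f = ∑ i, f (x_i) / ∏_{l ≠ i} (x_i - x_l)` for the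
divided difference of `f`. It sends a polynomial of degree less than `n` to its coefficient of
degree `n - 1`, so replacing the first column of the alternant of the factorial powers
`(x_i | c) ^ (n - j)` by an arbitrary vector `f` multiplies its determinant by `D f`. Hence
`h_k (x | c) = D ((· | c) ^ (k + n - 1))` and `g_k (x | c) = (-1) ^ (n - 1) D ((· | c) ^ (-k - 1))`
(`complete_eq_dividedDiff`, `dualComplete_eq_dividedDiff`), and both formulas persist for
`1 - n ≤ k < 0`, where the divided difference vanishes.

In the Jacobi–Trudi matrix, the shift by `τ ^ (1 - j)` makes the exponents of a row factor
(`factPow_shift_add`): up to the sign of `g`, the entry in column `j` (counted from `0`) is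
`D ((· | τ ^ (-j) c) ^ j * (· | c) ^ e)`, where the exponent `e` is an exponent of the numerator of
`s_{lam - (q ^ n)}` and depends only on the row. The matrix is therefore a product of the transposed
numerator matrix with permuted rows, the diagonal matrix of weights of `D`, and the matrix
`B = [(x_l | τ ^ (-j) c) ^ j]`. Multiplying the last two on the left by the transposed alternant of the
denominator gives a unitriangular matrix (`det_alternant_mul_det`), so their determinant is the
inverse of the denominator. The rows are permuted by the `p`-th power of a cycle of length `n`, of
sign `(-1) ^ (p (n - 1))`, and this cancels the sign `(-1) ^ (q (n - 1))` of the `q` rows of `g`'s.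
-/

namespace FactorialSchur

open Polynomial Matrix

variable {K : Type*} [Field K] {n : ℕ}

/-! ### Factorial powers -/

/-- The factorial power of nonnegative exponent `m`, as a polynomial in its first argument. -/
noncomputable def factPoly (c : ℤ → K) (m : ℕ) : K[X] :=
  ∏ l ∈ Finset.range m, (X - C (c (l : ℤ)))

lemma factPoly_monic (c : ℤ → K) (m : ℕ) : (factPoly c m).Monic :=
  monic_prod_of_monic _ _ fun _ _ => monic_X_sub_C _

lemma natDegree_factPoly (c : ℤ → K) (m : ℕ) : (factPoly c m).natDegree = m := by
  rw [factPoly, natDegree_prod_of_monic _ _ fun _ _ => monic_X_sub_C _]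
  simp

lemma factPow_natCast (y : K) (c : ℤ → K) (m : ℕ) :
    factPow y c (m : ℤ) = (factPoly c m).eval y := by
  rw [factPoly, eval_prod]
  simp [factPow]

lemma factPow_zero (y : K) (c : ℤ → K) : factPow y c 0 = 1 := by
  simpa [factPoly] using factPow_natCast y c 0

lemma factPow_add_one {y : K} {c : ℤ → K} (hy : ∀ m < 0, y ≠ c m) (e : ℤ) :
    factPow y c (e + 1) = factPow y c e * (y - c e) := by
  obtain m | m := e
  · exact Finset.prod_range_succ _ _
  · have hne : y - c (Int.negSucc m) ≠ 0 := sub_ne_zero.2 (hy _ (Int.negSucc_lt_zero m))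
    have hidx : -((m : ℤ) + 1) = Int.negSucc m := (Int.negSucc_eq m).symm
    obtain _ | m := m
    · have h : Int.negSucc 0 + 1 = 0 := rfl
      rw [h, factPow_zero]
      simp only [factPow, zero_add, Finset.prod_range_one, hidx]
      rw [inv_mul_cancel₀ hne]
    · have h : Int.negSucc (m + 1) + 1 = Int.negSucc m := by lia
      rw [h]
      simp only [factPow]
      rw [Finset.prod_range_succ _ (m + 1), hidx, mul_inv, mul_assoc, inv_mul_cancel₀ hne,
        mul_one]

/-- The factorial power of exponent `e + j` splits after its first `j` factors. -/
lemma factPow_shift_add {y : K} {c : ℤ → K} (hy : ∀ m < 0, y ≠ c m) (j : ℕ) (e : ℤ) :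
    factPow y (shift (-j) c) (e + j) = factPow y (shift (-j) c) j * factPow y c e := by
  have hy' : ∀ m < 0, y ≠ shift (-j) c m := fun m hm => hy _ (by lia)
  have hshift (e : ℤ) : shift (-j) c (e + j) = c e := by simp [shift]
  induction e using Int.induction_on with
  | zero => simp [factPow_zero]
  | succ e ih =>
    rw [add_right_comm, factPow_add_one hy', ih, hshift, factPow_add_one hy, mul_assoc]
  | pred e ih =>
    -- both sides are determined by their successors, as the factor `y - c (-e - 1)` is nonzero
    have h1 := factPow_add_one hy' (-(e : ℤ) - 1 + j)
    rw [hshift, add_right_comm, sub_add_cancel, ih] at h1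
    have h2 := factPow_add_one hy (-(e : ℤ) - 1)
    rw [sub_add_cancel] at h2
    rw [h2, ← mul_assoc] at h1
    exact (mul_right_cancel₀ (sub_ne_zero.2 (hy _ (by lia))) h1).symm

/-! ### Divided differences -/

/-- The weight `1 / ∏_{l ≠ i} (x_i - x_l)` of the node `x_i` in the divided difference. -/
def weight (x : Fin n → K) (i : Fin n) : K := (∏ l ∈ Finset.univ.erase i, (x i - x l))⁻¹

/-- The divided difference at the nodes `x` of a function, given by its values `f` at the nodes. -/
def dividedDiff (x : Fin n → K) (f : Fin n → K) : K := ∑ i, f i * weight x i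

lemma dividedDiff_eval {x : Fin n → K} (hx : Function.Injective x) {P : K[X]}
    (hP : P.degree < n) : dividedDiff x (fun i => P.eval (x i)) = P.coeff (n - 1) := by
  have h := Lagrange.coeff_eq_sum (s := Finset.univ) (v := x) hx.injOn (P := P) (by simpa using hP)
  rw [Finset.card_univ, Fintype.card_fin] at h
  simp [h, dividedDiff, weight, div_eq_mul_inv]

lemma dividedDiff_monic {x : Fin n → K} (hx : Function.Injective x) {P : K[X]}
    (hP : P.Monic) (hd : P.natDegree + 1 = n) :
    dividedDiff x (fun i => P.eval (x i)) = 1 := by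
  rw [dividedDiff_eval hx, ← hd, Nat.add_sub_cancel, hP.coeff_natDegree]
  rw [degree_eq_natDegree hP.ne_zero]
  exact_mod_cast by lia

lemma dividedDiff_eq_zero {x : Fin n → K} (hx : Function.Injective x) {P : K[X]}
    (hd : P.natDegree + 1 < n) : dividedDiff x (fun i => P.eval (x i)) = 0 := by
  rw [dividedDiff_eval hx, coeff_eq_zero_of_natDegree_lt (by lia)]
  exact degree_le_natDegree.trans_lt (by exact_mod_cast by lia)

/-! ### The alternant of factorial powers -/

/-- The matrix `[(x_i | c) ^ (n - 1 - j)]`, with indices starting at `0`. -/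
def alternant (x : Fin n → K) (c : ℤ → K) : Matrix (Fin n) (Fin n) K :=
  of fun i j : Fin n => factPow (x i) c ((n : ℤ) - 1 - (j : ℤ))

lemma alternant_apply (x : Fin n → K) (c : ℤ → K) (i j : Fin n) :
    alternant x c i j = (factPoly c (n - 1 - j)).eval (x i) := by
  have := j.isLt
  rw [alternant, of_apply, ← factPow_natCast]
  congr 1
  lia

/-- The increasing and the decreasing alternants are inverse to each other, up to triangular
factors, for the bilinear form `(f, g) ↦ D (f g)` defined by the divided difference. -/
lemma det_alternant_mul_det {x : Fin n → K} (hx : Function.Injective x) (c : ℤ → K)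
    (c' : ℕ → ℤ → K) :
    (alternant x c).det *
      (of fun l j : Fin n => weight x l * factPow (x l) (c' j) (j : ℕ)).det = 1 := by
  rw [← det_transpose (alternant x c), ← det_mul]
  set W : Matrix (Fin n) (Fin n) K :=
    (alternant x c)ᵀ * of fun l j : Fin n => weight x l * factPow (x l) (c' j) (j : ℕ) with hW
  have hentry (i j : Fin n) : W i j = dividedDiff x fun l =>
      (factPoly c (n - 1 - i) * factPoly (c' j) j).eval (x l) := by
    simp only [hW, mul_apply, transpose_apply, of_apply, alternant_apply, factPow_natCast,
      dividedDiff, eval_mul]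
    exact Finset.sum_congr rfl fun l _ => by ring
  have hdeg (i j : Fin n) :
      (factPoly c (n - 1 - i) * factPoly (c' j) j).natDegree = n - 1 - i + j := by
    rw [(factPoly_monic _ _).natDegree_mul (factPoly_monic _ _), natDegree_factPoly,
      natDegree_factPoly]
  rw [det_of_isUpperTriangular]
  · refine Finset.prod_eq_one fun i _ => ?_
    rw [hentry, dividedDiff_monic hx ((factPoly_monic _ _).mul (factPoly_monic _ _))]
    rw [hdeg]
    lia
  · intro i j hij
    have hij' : j < i := hij
    rw [hentry, dividedDiff_eq_zero hx]
    rw [hdeg]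
    lia

lemma det_alternant_ne_zero {x : Fin n → K} (hx : Function.Injective x) (c : ℤ → K) :
    (alternant x c).det ≠ 0 :=
  left_ne_zero_of_mul_eq_one (det_alternant_mul_det hx c fun _ => c)

lemma det_alternant_updateCol {x : Fin n → K} (hx : Function.Injective x) (c : ℤ → K)
    (hn : 0 < n) (f : Fin n → K) :
    ((alternant x c).updateCol ⟨0, hn⟩ f).det = dividedDiff x f * (alternant x c).det := by
  set a := (alternant x c)⁻¹ *ᵥ f with ha
  have hf : f = fun k => ∑ j, a j • alternant x c k j := by
    have h : alternant x c *ᵥ a = f := by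
      rw [ha, mulVec_mulVec, mul_nonsing_inv _ (det_alternant_ne_zero hx c).isUnit, one_mulVec]
    rw [← h]
    ext k
    simp [mulVec, dotProduct, mul_comm]
  have hD : dividedDiff x f = a ⟨0, hn⟩ := by
    have hcol (j : Fin n) : dividedDiff x (fun k => alternant x c k j) =
        if j = ⟨0, hn⟩ then 1 else 0 := by
      simp only [alternant_apply]
      split_ifs with h
      · refine dividedDiff_monic hx (factPoly_monic _ _) ?_
        rw [natDegree_factPoly, h]
        exact Nat.sub_add_cancel hn
      · refine dividedDiff_eq_zero hx ?_
        have : (j : ℕ) ≠ 0 := fun h' => h (Fin.ext h')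
        rw [natDegree_factPoly]
        lia
    calc dividedDiff x f = ∑ j, a j * dividedDiff x (fun k => alternant x c k j) := by
          rw [hf]
          simp only [dividedDiff, Finset.sum_mul, Finset.mul_sum, smul_eq_mul]
          rw [Finset.sum_comm]
          simp only [mul_assoc]
      _ = a ⟨0, hn⟩ := by simp [hcol]
  rw [hD, hf, det_updateCol_sum, smul_eq_mul]

/-! ### Complete and dual complete functions as divided differences -/

/-- For `1 - n ≤ k < 0` both sides vanish, the factorial power being a polynomial of degree less
than `n - 1`. This range is needed, since it occurs among the entries of the Jacobi–Trudi matrix. -/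
lemma complete_eq_dividedDiff {x : Fin n → K} (hx : Function.Injective x) (c : ℤ → K)
    (hn : 0 < n) {k : ℤ} (hk : 0 ≤ k + n - 1) :
    complete k x c = dividedDiff x fun i => factPow (x i) c (k + n - 1) := by
  rw [complete]
  split_ifs with hneg
  · lift k + n - 1 to ℕ using hk with m hm
    simp only [factPow_natCast]
    rw [dividedDiff_eq_zero hx]
    rw [natDegree_factPoly]
    lia
  · rw [schur, eq_comm]
    change _ = _ / (alternant x c).det
    rw [eq_div_iff (det_alternant_ne_zero hx c), ← det_alternant_updateCol hx c hn]
    congr 1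
    ext i j
    by_cases h : j = ⟨0, hn⟩
    · subst h
      simp
    · have h' : (j : ℕ) ≠ 0 := fun h' => h (Fin.ext h')
      simp [updateCol_ne h, alternant, h']

/-- In the numerator of `g_k` the nonpolynomial column comes last; a cyclic permutation of the
columns moves it to the front, whence the sign. As for `complete_eq_dividedDiff`, both sides vanish
for `1 - n ≤ k < 0`. -/
lemma dualComplete_eq_dividedDiff {x : Fin n → K} (hx : Function.Injective x) (c : ℤ → K)
    (hn : 0 < n) {k : ℤ} (hk : 0 ≤ k + n - 1) :
    dualComplete k x c =
      (-1) ^ (n - 1) * dividedDiff x fun i => factPow (x i) c (-k - 1) := by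
  rw [dualComplete]
  split_ifs with hneg
  · have hk' : 0 ≤ -k - 1 := by lia
    lift -k - 1 to ℕ using hk' with m hm
    simp only [factPow_natCast]
    rw [dividedDiff_eq_zero hx, mul_zero]
    rw [natDegree_factPoly]
    lia
  · rw [schur, eq_comm]
    change _ = _ / (alternant x c).det
    rw [eq_div_iff (det_alternant_ne_zero hx c), mul_assoc, ← det_alternant_updateCol hx c hn]
    obtain ⟨n, rfl⟩ : ∃ m, n = m + 1 := ⟨n - 1, by lia⟩
    have hsign := det_permute' (finRotate (n + 1)) ((alternant x c).updateCol ⟨0, hn⟩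
      fun i => factPow (x i) c (-k - 1))
    rw [sign_finRotate, Nat.add_sub_cancel] at hsign
    push_cast at hsign
    rw [Nat.add_sub_cancel, ← hsign]
    congr 1
    ext i j
    rw [submatrix_apply, id_eq, of_apply]
    by_cases h : j = Fin.last n
    · subst h
      rw [finRotate_last, ← Fin.mk_zero', updateCol_self]
      congr 1
      simp
      ring
    · have hj := coe_finRotate_of_ne_last h
      have h' : (j : ℕ) ≠ n := fun h' => h (Fin.ext h')
      rw [updateCol_ne fun h0 => by rw [h0] at hj; simp at hj]
      rw [alternant, of_apply, hj]
      congr 1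
      simp [h']
      ring

lemma coe_finRotate_pow (k : ℕ) (i : Fin n) : ((finRotate n ^ k) i : ℕ) = (i + k) % n := by
  have := i.neZero
  induction k with
  | zero => simp [Nat.mod_eq_of_lt i.isLt]
  | succ k ih =>
    rw [pow_succ', Equiv.Perm.mul_apply, finRotate_apply, Fin.val_add, ih, Fin.val_one',
      ← Nat.add_mod, add_assoc]

/-! ### The Jacobi–Trudi matrix -/

/-- The exponent of the factorial powers in column `j` of the numerator of `s_{lam - (q ^ n)}`,
where `lam = (μ, ν)` and `n = p + q`. -/
def numExp {p q : ℕ} (μ : Fin p → ℕ) (ν : Fin q → ℕ) (j : Fin (p + q)) : ℤ :=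
  composite μ ν j - q + ((p + q : ℕ) : ℤ) - 1 - j

/-- The entries of row `r` all come from one numerator exponent. The rows of `g`'s come first but
carry the last `q` exponents, so the exponent of row `r` has the index `r + p` modulo `p + q`. -/
lemma jacobiTrudiMatrix_apply {p q : ℕ} (μ : Fin p → ℕ) (ν : Fin q → ℕ)
    {x : Fin (p + q) → K} (hx : Function.Injective x) {c : ℤ → K}
    (hc : ∀ (i : Fin (p + q)) (m : ℤ), m < 0 → x i ≠ c m) (r j : Fin (p + q)) :
    jacobiTrudiMatrix μ ν x c r j = (if (r : ℕ) < q then (-1) ^ (p + q - 1) else 1) *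
      dividedDiff x fun l => factPow (x l) (shift (-(j : ℕ)) c) (j : ℕ) *
        factPow (x l) c (numExp μ ν ((finRotate (p + q) ^ p) r)) := by
  have hn : 0 < p + q := j.pos
  have hj := j.isLt
  obtain ⟨r, rfl⟩ : ∃ r' : Fin (q + p), r = Fin.cast (Nat.add_comm q p) r' :=
    ⟨Fin.cast (Nat.add_comm p q) r, rfl⟩
  simp only [← factPow_shift_add (hc _)]
  induction r using Fin.addCases with
  | left i =>
    have hrot : (finRotate (p + q) ^ p) (Fin.cast (Nat.add_comm q p) (Fin.castAdd p i)) =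
        Fin.natAdd p i := by
      ext
      rw [coe_finRotate_pow, Nat.mod_eq_of_lt] <;> simp <;> lia
    have hexp : numExp μ ν (Fin.natAdd p i) + (j : ℕ) =
        -((ν (Fin.rev i) : ℤ) + i - j) - 1 := by
      simp [numExp, composite]
      ring
    rw [hrot, hexp, if_pos (by simp), ← dualComplete_eq_dividedDiff hx _ hn (by push_cast; lia)]
    simp [jacobiTrudiMatrix]
  | right i =>
    have hi := i.isLt
    have hrot : (finRotate (p + q) ^ p) (Fin.cast (Nat.add_comm q p) (Fin.natAdd q i)) =
        Fin.castAdd q i := by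
      ext
      rw [coe_finRotate_pow]
      have h : ((Fin.cast (Nat.add_comm q p) (Fin.natAdd q i) : Fin (p + q)) : ℕ) + p =
          i + (p + q) := by
        simp
        ring
      rw [h, Nat.add_mod_right, Nat.mod_eq_of_lt (by lia), Fin.val_castAdd]
    have hexp : numExp μ ν (Fin.castAdd q i) + (j : ℕ) =
        ((μ i : ℤ) - q - i + j) + ((p + q : ℕ) : ℤ) - 1 := by
      simp [numExp, composite]
      ring
    rw [hrot, hexp, if_neg (by simp), one_mul,
      ← complete_eq_dividedDiff hx _ hn (by push_cast; lia)]
    simp [jacobiTrudiMatrix]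

end FactorialSchur

open FactorialSchur Matrix in
theorem mainTheorem6 {K : Type*} [Field K] (p q : ℕ)
    (μ : Fin p → ℕ) (hμ : Antitone μ) (ν : Fin q → ℕ) (hν : Antitone ν)
    (x : Fin (p + q) → K) (hx : Function.Injective x)
    (c : ℤ → K) (hc : ∀ (i : Fin (p + q)) (m : ℤ), m < 0 → x i ≠ c m) :
    FactorialSchur.schur (fun i => FactorialSchur.composite μ ν i - (q : ℤ)) x c =
      (FactorialSchur.jacobiTrudiMatrix μ ν x c).det := by
  set N : Matrix (Fin (p + q)) (Fin (p + q)) K :=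
    of fun i j => factPow (x i) c (numExp μ ν j) with hN
  set B : Matrix (Fin (p + q)) (Fin (p + q)) K :=
    of fun l j => weight x l * factPow (x l) (shift (-(j : ℕ)) c) (j : ℕ) with hB
  set ρ := finRotate (p + q) ^ p with hρ
  set s : Fin (p + q) → K := fun r => if (r : ℕ) < q then (-1) ^ (p + q - 1) else 1 with hs
  have hmat : jacobiTrudiMatrix μ ν x c =
      of fun r j => s r * (Nᵀ.submatrix ρ id * B) r j := by
    ext r j
    rw [jacobiTrudiMatrix_apply μ ν hx hc, of_apply, mul_apply, dividedDiff]
    congr 1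
    refine Finset.sum_congr rfl fun l _ => ?_
    simp only [hN, hB, submatrix_apply, transpose_apply, of_apply, id_eq]
    ring
  have hsprod : ∏ r, s r = (-1) ^ ((p + q - 1) * q) := by
    rw [hs, Fin.prod_univ_eq_prod_range (fun r => if r < q then (-1 : K) ^ (p + q - 1) else 1),
      add_comm p q, Finset.prod_range_add, Finset.prod_congr rfl fun r hr =>
        if_pos (Finset.mem_range.1 hr), Finset.prod_congr rfl fun r _ =>
        if_neg (by lia : ¬ q + r < q)]
    simp [pow_mul]
  have hsign : (-1 : K) ^ ((p + q - 1) * q) * ((Equiv.Perm.sign ρ : ℤ) : K) = 1 := by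
    rw [hρ, map_pow, sign_finRotate]
    push_cast
    rw [← pow_mul, ← pow_add, ← mul_add, add_comm q p]
    -- the total exponent is `(n - 1) * n` for `n = p + q`
    refine Even.neg_one_pow ?_
    rw [mul_comm]
    exact Nat.even_mul_pred_self _
  have hden : B.det = (alternant x c).det⁻¹ :=
    eq_inv_of_mul_eq_one_right (det_alternant_mul_det hx c fun j => shift (-(j : ℤ)) c)
  rw [hmat, det_mul_column, hsprod, det_mul, det_permute, det_transpose, ← mul_assoc, ← mul_assoc,
    hsign, one_mul, hden, ← div_eq_mul_inv]
  rfl
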